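/- Let $\mathbf{\Delta}$ be the set of distance distribution functions, i.e. of functions $\varphi:[0,\infty]\to[0,1]$ with $\varphi(\beta)=\sup_{\alpha<\beta}\varphi(\alpha)$ for all $\beta\in[0,\infty]$. Ordered pointwise, $\mathbf{\Delta}$ is a complete lattice with bottom element the constant function $0$; let $\bigvee,\bigwedge$ denote its suprema and infima. Put $(\varphi\odot\psi)(\gamma)=\sup_{\alpha+\beta\le\gamma}\varphi(\alpha)\psi(\beta)$, and let $\kappa\in\mathbf{\Delta}$ be the function with $\kappa(0)=0$ and $\kappa(\alpha)=1$ for $\alpha>0$. A probabilistic approach structure on a set $X$ is a function $\delta:X\times\mathsf{P}X\to\mathbf{\Delta}$ such that, for all $x\in X$, $A,B\subseteq X$, $\varphi\in\mathbf{\Delta}$: $\delta(x,\{x\})=\kappa$; $\delta(x,\emptyset)=0$; $\delta(x,A\cup B)=\delta(x,A)\vee\delta(x,B)$; and $\delta(x,A)\ge\delta(x,A^{(\varphi)})\odot\varphi$, where $A^{(\varphi)}=\{y\in X\mid\delta(y,A)\ge\varphi\}$. A map $f:(X,\delta)\to(Y,\varepsilon)$ between sets with such structures is contractive if $\delta(x,A)\le\varepsilon(fx,f(A))$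 for all $x\in X$, $A\subseteq X$. Let $\mathsf{U}X$ be the set of ultrafilters on $X$. For $x\in X$ let $\dot x$ be the principal ultrafilter at $x$; for $\mathfrak{X}\in\mathsf{U}\mathsf{U}X$ let $\Sigma\mathfrak{X}\in\mathsf{U}X$ be given by $A\in\Sigma\mathfrak{X}\iff\{\mathfrak{x}\in\mathsf{U}X\mid A\in\mathfrak{x}\}\in\mathfrak{X}$; for $f:X\to Y$ and $\mathfrak{x}\in\mathsf{U}X$ let $f[\mathfrak{x}]\in\mathsf{U}Y$ be given by $B\in f[\mathfrak{x}]\iff f^{-1}(B)\in\mathfrak{x}$. **Corollary 3.7.** (1) For every set $X$, the assignments $$\delta\mapsto\ell,\quad \ell(\mathfrak{x})(x)=\bigwedge_{A\in\mathfrak{x}}\delta(x,A),\qquad\qquad \ell\mapsto\delta,\quad \delta(x,A)=\bigvee_{\mathfrak{x}\in\mathsf{U}X,\,\mathfrak{x}\ni A}\ell(\mathfrak{x})(x),$$ are mutually inverse bijections between the probabilistic approach structures $\delta$ on $X$ and the maps $\ell:\mathsf{U}X\to\mathbf{\Delta}^X$ satisfying, for all $x,z\in X$, $\mathfrak{X}\in\mathsf{U}\mathsf{U}X$,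 $\mathfrak{y}\in\mathsf{U}X$, * (R″) $\kappa\le\ell(\dot x)(x)$, * (T″) $\Big(\bigwedge_{\mathcal{A}\in\mathfrak{X},\,B\in\mathfrak{y}}\ \bigvee_{\mathfrak{x}\in\mathcal{A},\,y\in B}\ell(\mathfrak{x})(y)\Big)\odot\ell(\mathfrak{y})(z)\le\ell(\Sigma\mathfrak{X})(z)$. (2) Let $(X,\delta)$ and $(Y,\varepsilon)$ be probabilistic approach spaces, with corresponding maps $\ell,\ell'$ as in (1). A map $f:X\to Y$ is contractive if and only if, for all $\mathfrak{x}\in\mathsf{U}X$ and $x\in X$, * (M″) $\ell(\mathfrak{x})(x)\le\ell'(f[\mathfrak{x}])(fx)$. -/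

import Mathlib

open scoped ENNReal

/-- A distance distribution function: a function `φ : [0,∞] → [0,1]` that is left-continuous in the
sense that `φ(β) = sup_{α < β} φ(α)` for all `β ∈ [0,∞]`. (For `β = 0` the supremum of the empty
set in `[0,1]` is `0`, so `φ(0) = 0`; monotonicity follows as well.) -/
@[ext]
structure DistDistrib where
  toFun : ℝ≥0∞ → unitInterval
  left_cont : ∀ β, toFun β = ⨆ α, ⨆ _ : α < β, toFun α

namespace DistDistrib

instance : CoeFun DistDistrib (fun _ => ℝ≥0∞ → unitInterval) := ⟨toFun⟩

/-- The order of `[0,1]`, pointwise. -/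
instance : PartialOrder DistDistrib :=
  PartialOrder.lift toFun (fun _ _ h => DistDistrib.ext h)

/-- Suprema of distance distribution functions are formed pointwise. -/
noncomputable instance : SupSet DistDistrib where
  sSup D :=
    { toFun := fun γ => ⨆ φ ∈ D, φ.toFun γ
      left_cont := fun β => by
        apply le_antisymm
        · refine iSup₂_le fun φ hφ => ?_
          rw [φ.left_cont β]
          refine iSup₂_le fun α hα => ?_
          exact le_trans (le_iSup₂ (f := fun (ψ : DistDistrib) (_ : ψ ∈ D) => ψ.toFun α) φ hφ)
            (le_iSup₂ (f := fun (α : ℝ≥0∞) (_ : α < β) => ⨆ ψ ∈ D, ψ.toFun α) α hα)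
        · refine iSup₂_le fun α hα => iSup₂_le fun φ hφ => ?_
          refine le_trans ?_
            (le_iSup₂ (f := fun (ψ : DistDistrib) (_ : ψ ∈ D) => ψ.toFun β) φ hφ)
          rw [φ.left_cont β]
          exact le_iSup₂ (f := fun (α : ℝ≥0∞) (_ : α < β) => φ.toFun α) α hα }

theorem isLUB_sSup' (D : Set DistDistrib) : IsLUB D (sSup D) := by
  constructor
  · intro φ hφ γ
    exact le_iSup₂ (f := fun (ψ : DistDistrib) (_ : ψ ∈ D) => ψ.toFun γ) φ hφ
  · intro ψ hψ γ
    exact iSup₂_le fun φ hφ => hψ hφ γ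

/-- Distance distribution functions form a complete lattice; infima are the greatest lower bounds
among distance distribution functions (in general not the pointwise infima). -/
noncomputable instance : CompleteLattice DistDistrib :=
  completeLatticeOfSup DistDistrib isLUB_sSup'

theorem iSup_mul_le {ι : Sort*} (f : ι → unitInterval) (b R : unitInterval)
    (h : ∀ i, f i * b ≤ R) : (⨆ i, f i) * b ≤ R := by
  by_contra hlt
  rw [not_le] at hlt
  have hR : (R : ℝ) < ((⨆ i, f i : unitInterval) : ℝ) * (b : ℝ) := hlt
  have hR0 : (0 : ℝ) ≤ R := R.2.1
  have hs1 : ((⨆ i, f i : unitInterval) : ℝ) ≤ 1 := (⨆ i, f i : unitInterval).2.2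
  have hb0 : (0 : ℝ) ≤ b := b.2.1
  have hb : (0 : ℝ) < b := by
    rcases hb0.lt_or_eq with h' | h'
    · exact h'
    · rw [← h', mul_zero] at hR
      linarith
  have hq : (R : ℝ) / b < ((⨆ i, f i : unitInterval) : ℝ) := (div_lt_iff₀ hb).2 hR
  let q : unitInterval := ⟨(R : ℝ) / b, div_nonneg hR0 hb0, (hq.trans_le hs1).le⟩
  have hq' : q < ⨆ i, f i := hq
  obtain ⟨i, hi⟩ := lt_iSup_iff.1 hq'
  have hi' : (R : ℝ) / b < (f i : ℝ) := hi
  have h1 : (R : ℝ) < (f i : ℝ) * b := (div_lt_iff₀ hb).1 hi'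
  have h2 : (f i : ℝ) * b ≤ R := h i
  linarith

/-- The convolution product `(φ ⊙ ψ)(γ) = sup_{α + β ≤ γ} φ(α) ψ(β)`. -/
noncomputable def conv (φ ψ : DistDistrib) : DistDistrib where
  toFun γ := ⨆ α, ⨆ β, ⨆ _ : α + β ≤ γ, φ α * ψ β
  left_cont γ := by
    apply le_antisymm
    · refine iSup_le fun α => iSup_le fun β => iSup_le fun hab => ?_
      rw [φ.left_cont α]
      refine iSup_mul_le _ _ _ fun α' => iSup_mul_le _ _ _ fun hα => ?_
      rw [ψ.left_cont β, mul_comm]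
      refine iSup_mul_le _ _ _ fun β' => iSup_mul_le _ _ _ fun hβ => ?_
      rw [mul_comm]
      refine le_iSup₂_of_le (α' + β') ((ENNReal.add_lt_add hα hβ).trans_le hab) ?_
      exact le_iSup_of_le α' (le_iSup_of_le β' (le_iSup_of_le le_rfl le_rfl))
    · refine iSup₂_le fun δ hδ => iSup_le fun α => iSup_le fun β => iSup_le fun hab => ?_
      exact le_iSup_of_le α (le_iSup_of_le β (le_iSup_of_le (hab.trans hδ.le) le_rfl))

infixl:70 " ⊙ " => DistDistrib.conv

/-- The function `κ` with `κ(0) = 0` and `κ(α) = 1` for `α > 0`, which is neutral for `⊙`. -/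
noncomputable def kappa : DistDistrib where
  toFun α := if α = 0 then 0 else 1
  left_cont β := by
    by_cases hβ : β = 0
    · subst hβ
      simp only [if_true, not_lt_zero, iSup_false, iSup_bot]
      rfl
    · rw [if_neg hβ]
      obtain ⟨α, h0, hα⟩ := exists_between (show (0 : ℝ≥0∞) < β from pos_iff_ne_zero.2 hβ)
      refine le_antisymm (le_iSup₂_of_le α hα ?_) le_top
      rw [if_neg h0.ne']

/-- The distance distribution function with constant value `0`. -/
noncomputable def zero : DistDistrib where
  toFun _ := 0
  left_cont := by
    intro β
    exact le_antisymm bot_le (iSup₂_le fun _ _ => le_rfl)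

end DistDistrib

/-- A probabilistic approach structure `δ : X × PX → Δ` on a set `X`. -/
structure IsProbApproach {X : Type*} (δ : X → Set X → DistDistrib) : Prop where
  singleton : ∀ x, δ x {x} = DistDistrib.kappa
  empty : ∀ x, δ x ∅ = DistDistrib.zero
  union : ∀ x A B, δ x (A ∪ B) = δ x A ⊔ δ x B
  transitive : ∀ x A (φ : DistDistrib), δ x {y | φ ≤ δ y A} ⊙ φ ≤ δ x A

/-- Contractive maps `f : (X, δ) → (Y, ε)` of probabilistic approach spaces. -/
def IsContractive {X Y : Type*} (δ : X → Set X → DistDistrib) (ε : Y → Set Y → DistDistrib)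
    (f : X → Y) : Prop :=
  ∀ x A, δ x A ≤ ε (f x) (f '' A)

/-- The multiplication `Σ` of the ultrafilter monad:
`A ∈ Σ 𝔛` if and only if `{𝔵 | A ∈ 𝔵} ∈ 𝔛`. -/
def ultrafilterSum {X : Type*} (𝔛 : Ultrafilter (Ultrafilter X)) : Ultrafilter X :=
  𝔛.bind id

theorem mem_ultrafilterSum {X : Type*} (𝔛 : Ultrafilter (Ultrafilter X)) (A : Set X) :
    A ∈ ultrafilterSum 𝔛 ↔ {𝔵 : Ultrafilter X | A ∈ 𝔵} ∈ 𝔛 :=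
  Iff.rfl

/-- The reflexivity and transitivity conditions for a map `ℓ : UX → Δ^X`. -/
structure IsUltraConvergence {X : Type*} (ℓ : Ultrafilter X → X → DistDistrib) : Prop where
  refl : ∀ x, DistDistrib.kappa ≤ ℓ (pure x) x
  trans : ∀ (𝔛 : Ultrafilter (Ultrafilter X)) (𝔶 : Ultrafilter X) (z : X),
    (⨅ 𝒜 ∈ 𝔛, ⨅ B ∈ 𝔶, ⨆ 𝔵 ∈ 𝒜, ⨆ y ∈ B, ℓ 𝔵 y) ⊙ ℓ 𝔶 z ≤ ℓ (ultrafilterSum 𝔛) z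

/-- The map `ℓ : UX → Δ^X` induced by `δ`: `ℓ(𝔵)(x) = ⋀_{A ∈ 𝔵} δ(x, A)`. -/
noncomputable def convergenceOf {X : Type*} (δ : X → Set X → DistDistrib) :
    Ultrafilter X → X → DistDistrib :=
  fun 𝔵 x => ⨅ A ∈ 𝔵, δ x A

/-- The function `δ : X × PX → Δ` induced by `ℓ`: `δ(x, A) = ⋁_{𝔵 ∋ A} ℓ(𝔵)(x)`. -/
noncomputable def distanceOf {X : Type*} (ℓ : Ultrafilter X → X → DistDistrib) :
    X → Set X → DistDistrib :=
  fun x A => ⨆ 𝔵 : Ultrafilter X, ⨆ _ : A ∈ 𝔵, ℓ 𝔵 x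

/-! ### Step functions and convolution -/

namespace DistDistrib

/-! The two assignments form a Galois connection, so one inequality in each round trip is formal.
For the rest, each `φ` is the supremum of the steps `step a u` with `u < φ a`, and such a step is
totally below `φ`: whenever `φ` lies under a supremum, the step lies under a single member
(`exists_step_le_of_le_iSup`). Since `⊙` preserves suprema, inequalities can be tested on steps. As
steps belong to the lattice, infima, which need not be pointwise, are never computed.

What remains is ultrafilter combinatorics: `exists_ultrafilter` recovers `δ` from its convergence,
and `exists_ultrafilterSum_eq` together with (T″) recovers `ℓ` from its distance. -/

theorem mono (φ : DistDistrib) {α β : ℝ≥0∞} (h : α ≤ β) : φ α ≤ φ β := by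
  rw [φ.left_cont α, φ.left_cont β]
  exact iSup₂_le fun γ hγ => le_iSup₂_of_le γ (hγ.trans_le h) le_rfl

theorem map_zero (φ : DistDistrib) : φ 0 = 0 := by
  rw [φ.left_cont 0]
  exact le_antisymm (iSup₂_le fun γ hγ => absurd hγ not_lt_zero) bot_le

theorem iSup_apply {ι : Sort*} (f : ι → DistDistrib) (a : ℝ≥0∞) :
    (⨆ i, f i : DistDistrib) a = ⨆ i, f i a :=
  iSup_range (g := fun φ : DistDistrib => φ a) (f := f)

theorem sup_apply (φ ψ : DistDistrib) (a : ℝ≥0∞) :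
    (φ ⊔ ψ : DistDistrib) a = φ a ⊔ ψ a := by
  rw [sup_eq_iSup, iSup_apply, sup_eq_iSup]
  exact iSup_congr fun b => by cases b <;> rfl

theorem bot_eq_zero : (⊥ : DistDistrib) = zero :=
  le_antisymm bot_le fun _ => bot_le

theorem le_kappa (φ : DistDistrib) : φ ≤ kappa := by
  intro a
  change φ a ≤ if a = 0 then 0 else 1
  split_ifs with h
  · rw [h, map_zero]
  · exact le_top

/-- The step function that jumps from `0` to `u` at `a`. These functions generate the lattice of
distance distribution functions under suprema. -/
noncomputable def step (a : ℝ≥0∞) (u : unitInterval) : DistDistrib where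
  toFun γ := if a < γ then u else 0
  left_cont β := by
    refine le_antisymm ?_ (iSup₂_le fun α hα => ?_)
    · split_ifs with h
      · obtain ⟨α, h0, hα⟩ := exists_between h
        exact le_iSup₂_of_le α hα (by rw [if_pos h0])
      · exact bot_le
    · split_ifs with h1 h2
      · exact le_rfl
      · exact absurd (h1.trans hα) h2
      · exact bot_le
      · exact le_rfl

theorem step_apply_of_lt {a γ : ℝ≥0∞} (u : unitInterval) (h : a < γ) : step a u γ = u :=
  if_pos h

theorem step_le {φ : DistDistrib} {a : ℝ≥0∞} {u : unitInterval} (h : u ≤ φ a) :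
    step a u ≤ φ := by
  intro γ
  change (if a < γ then u else 0) ≤ φ γ
  split_ifs with hγ
  · exact h.trans (φ.mono hγ.le)
  · exact bot_le

/-- Left continuity reduces the value at `γ` to the values at `α < γ`, where a step jumping at `α`
has already reached its height. -/
theorem le_of_step_le {φ ψ : DistDistrib} (h : ∀ a u, u < φ a → step a u ≤ ψ) : φ ≤ ψ := by
  intro γ
  change φ γ ≤ ψ γ
  rw [φ.left_cont γ]
  refine iSup₂_le fun α hα => le_of_forall_lt fun u hu => ?_
  obtain ⟨v, huv, hv⟩ := exists_between hu
  have := h α v hv γ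
  change step α v γ ≤ ψ γ at this
  rw [step_apply_of_lt v hα] at this
  exact huv.trans_le this

/-- Step functions strictly below `φ` are totally below `φ`. -/
theorem exists_step_le_of_le_iSup {ι : Sort*} {φ : DistDistrib} {f : ι → DistDistrib}
    (h : φ ≤ ⨆ i, f i) {a : ℝ≥0∞} {u : unitInterval} (hu : u < φ a) :
    ∃ i, step a u ≤ f i := by
  have h1 : u < ⨆ i, f i a := by
    rw [← iSup_apply]
    exact hu.trans_le (h a)
  obtain ⟨i, hi⟩ := lt_iSup_iff.1 h1
  exact ⟨i, step_le hi.le⟩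

theorem le_conv_apply (φ ψ : DistDistrib) {α β γ : ℝ≥0∞} (h : α + β ≤ γ) :
    φ α * ψ β ≤ (φ ⊙ ψ) γ :=
  le_iSup_of_le α (le_iSup_of_le β (le_iSup_of_le h le_rfl))

theorem conv_le_iff {φ ψ χ : DistDistrib} :
    φ ⊙ ψ ≤ χ ↔ ∀ α β γ, α + β ≤ γ → φ α * ψ β ≤ χ γ :=
  ⟨fun h _ _ γ hγ => (le_conv_apply φ ψ hγ).trans (h γ),
    fun h γ => iSup_le fun α => iSup_le fun β => iSup_le fun hγ => h α β γ hγ⟩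

theorem conv_comm (φ ψ : DistDistrib) : φ ⊙ ψ = ψ ⊙ φ := by
  refine le_antisymm (conv_le_iff.2 fun α β γ h => ?_) (conv_le_iff.2 fun α β γ h => ?_) <;>
  · rw [mul_comm]
    exact le_conv_apply _ _ (by rwa [add_comm])

theorem conv_mono {φ φ' ψ ψ' : DistDistrib} (h : φ ≤ φ') (h' : ψ ≤ ψ') :
    φ ⊙ ψ ≤ φ' ⊙ ψ' :=
  conv_le_iff.2 fun α β _ hγ =>
    (mul_le_mul' (h α) (h' β)).trans (le_conv_apply φ' ψ' hγ)

theorem iSup_conv_le {ι : Sort*} {f : ι → DistDistrib} {ψ χ : DistDistrib}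
    (h : ∀ i, f i ⊙ ψ ≤ χ) : (⨆ i, f i) ⊙ ψ ≤ χ := by
  refine conv_le_iff.2 fun α β γ hγ => ?_
  rw [iSup_apply]
  exact iSup_mul_le _ _ _ fun i => conv_le_iff.1 (h i) α β γ hγ

theorem conv_le_of_step_conv_le {φ ψ χ : DistDistrib}
    (h : ∀ a u, u < φ a → step a u ⊙ ψ ≤ χ) : φ ⊙ ψ ≤ χ := by
  have hφ : φ ≤ ⨆ p : {p : ℝ≥0∞ × unitInterval // p.2 < φ p.1}, step p.1.1 p.1.2 :=
    le_of_step_le fun a u hu =>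
      le_iSup (fun p : {p : ℝ≥0∞ × unitInterval // p.2 < φ p.1} => step p.1.1 p.1.2)
        ⟨(a, u), hu⟩
  exact (conv_mono hφ le_rfl).trans (iSup_conv_le fun p => h p.1.1 p.1.2 p.2)

theorem le_conv_kappa (φ : DistDistrib) : φ ≤ φ ⊙ kappa := by
  intro γ
  change φ γ ≤ (φ ⊙ kappa) γ
  rw [φ.left_cont γ]
  refine iSup₂_le fun α hα => ?_
  have h := le_conv_apply φ kappa (add_tsub_cancel_of_le hα.le).le
  have hk : kappa (γ - α) = 1 := if_neg (tsub_pos_of_lt hα).ne'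
  rwa [hk, mul_one] at h

end DistDistrib

open DistDistrib

theorem distanceOf_mono {X : Type*} (ℓ : Ultrafilter X → X → DistDistrib) (x : X)
    {A B : Set X} (h : A ⊆ B) : distanceOf ℓ x A ≤ distanceOf ℓ x B :=
  iSup₂_le fun 𝔵 hA => le_iSup₂_of_le 𝔵 (Filter.mem_of_superset hA h) le_rfl

theorem le_distanceOf {X : Type*} (ℓ : Ultrafilter X → X → DistDistrib) (x : X)
    {A : Set X} {𝔵 : Ultrafilter X} (h : A ∈ 𝔵) : ℓ 𝔵 x ≤ distanceOf ℓ x A :=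
  le_iSup₂_of_le 𝔵 h le_rfl

theorem convergenceOf_le {X : Type*} (δ : X → Set X → DistDistrib) (x : X)
    {A : Set X} {𝔵 : Ultrafilter X} (h : A ∈ 𝔵) : convergenceOf δ 𝔵 x ≤ δ x A :=
  iInf₂_le A h

theorem distanceOf_convergenceOf_le {X : Type*} (δ : X → Set X → DistDistrib) :
    distanceOf (convergenceOf δ) ≤ δ :=
  fun x _ => iSup₂_le fun _ hA => convergenceOf_le δ x hA

theorem le_convergenceOf_distanceOf {X : Type*} (ℓ : Ultrafilter X → X → DistDistrib) :
    ℓ ≤ convergenceOf (distanceOf ℓ) :=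
  fun _ x => le_iInf₂ fun _ hA => le_distanceOf ℓ x hA

/-! ### From distances to convergence -/

namespace IsProbApproach

variable {X : Type*} {δ : X → Set X → DistDistrib}

theorem mono (h : IsProbApproach δ) (x : X) {A B : Set X} (hAB : A ⊆ B) : δ x A ≤ δ x B := by
  rw [← Set.union_eq_self_of_subset_left hAB, h.union]
  exact le_sup_left

/-- The filter of all sets whose complements are at distance at most `u` at the parameter `a`. -/
def smallComplFilter (h : IsProbApproach δ) (x : X) (a : ℝ≥0∞) (u : unitInterval) :
    Filter X where
  sets := {B | δ x Bᶜ a ≤ u}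
  univ_sets := by
    rw [Set.mem_ofPred_eq, Set.compl_univ, h.empty]
    exact bot_le
  sets_of_superset hB hBC := le_trans (h.mono x (Set.compl_subset_compl.2 hBC) a) hB
  inter_sets {B C} hB hC := by
    rw [Set.mem_ofPred_eq, Set.compl_inter, h.union, sup_apply]
    exact sup_le hB hC

/-- The sets with `δ x B a ≤ u` form an ideal not containing `A`. Some ultrafilter therefore
contains `A` and avoids the ideal. -/
theorem exists_ultrafilter (h : IsProbApproach δ) {x : X} {A : Set X} {a : ℝ≥0∞}
    {u : unitInterval} (hu : u < δ x A a) :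
    ∃ 𝔵 : Ultrafilter X, A ∈ 𝔵 ∧ ∀ B ∈ 𝔵, u < δ x B a := by
  have hne : (h.smallComplFilter x a u ⊓ Filter.principal A).NeBot := by
    rw [Filter.inf_principal_neBot_iff]
    intro B hB
    by_contra hne
    rw [Set.not_nonempty_iff_eq_empty, ← Set.disjoint_iff_inter_eq_empty,
      ← Set.subset_compl_iff_disjoint_left] at hne
    exact (hu.trans_le (h.mono x hne a)).not_ge hB
  refine ⟨Ultrafilter.of (h.smallComplFilter x a u ⊓ Filter.principal A), ?_, fun B hB => ?_⟩
  · exact Ultrafilter.of_le _ (Filter.mem_inf_of_right (Filter.mem_principal_self A))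
  · by_contra hBu
    have hc : Bᶜ ∈ h.smallComplFilter x a u := by
      change δ x Bᶜᶜ a ≤ u
      rw [compl_compl]
      exact not_lt.1 hBu
    exact Ultrafilter.compl_notMem_iff.2 hB (Ultrafilter.of_le _ (Filter.mem_inf_of_left hc))

theorem distanceOf_convergenceOf (h : IsProbApproach δ) :
    distanceOf (convergenceOf δ) = δ := by
  refine le_antisymm (distanceOf_convergenceOf_le δ) fun x A => le_of_step_le fun a u hu => ?_
  obtain ⟨𝔵, hA, h𝔵⟩ := h.exists_ultrafilter hu
  exact le_iSup₂_of_le 𝔵 hA (le_iInf₂ fun B hB => step_le (h𝔵 B hB).le)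

theorem isUltraConvergence (h : IsProbApproach δ) : IsUltraConvergence (convergenceOf δ) where
  refl x := by
    refine le_iInf₂ fun A hA => ?_
    rw [← h.singleton x]
    exact h.mono x (Set.singleton_subset_iff.2 (Ultrafilter.mem_pure.1 hA))
  trans 𝔛 𝔶 z := by
    refine le_iInf₂ fun A hA => conv_le_of_step_conv_le fun a u hu => ?_
    -- Otherwise the complement is an admissible `B` in the infimum. Paired with the ultrafilters
    -- containing `A`, it puts the step below `δ y A` for some `y` in that complement.
    have hA' : {y | step a u ≤ δ y A} ∈ 𝔶 := by
      by_contra hnot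
      have hB := Ultrafilter.compl_mem_iff_notMem.2 hnot
      have hle : (⨅ 𝒜 ∈ 𝔛, ⨅ B ∈ 𝔶, ⨆ 𝔵 ∈ 𝒜, ⨆ y ∈ B, convergenceOf δ 𝔵 y) ≤
          ⨆ y : ({y | step a u ≤ δ y A}ᶜ : Set X), δ y A :=
        (iInf₂_le _ ((mem_ultrafilterSum 𝔛 A).1 hA)).trans <| (iInf₂_le _ hB).trans <|
          iSup₂_le fun 𝔵 h𝔵 => iSup₂_le fun y hy =>
            (convergenceOf_le δ y h𝔵).trans
              (le_iSup (fun y : ({y | step a u ≤ δ y A}ᶜ : Set X) => δ y A) ⟨y, hy⟩)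
      obtain ⟨y, hy⟩ := exists_step_le_of_le_iSup hle hu
      exact y.2 hy
    rw [conv_comm]
    exact (conv_mono (convergenceOf_le δ z hA') le_rfl).trans (h.transitive z A _)

end IsProbApproach

/-- An ultrafilter of ultrafilters with prescribed sum, concentrated on a given set. -/
theorem exists_ultrafilterSum_eq {X : Type*} {𝔵 : Ultrafilter X} {S : Set (Ultrafilter X)}
    (hS : ∀ A ∈ 𝔵, ∃ 𝔷 ∈ S, A ∈ 𝔷) :
    ∃ 𝔛 : Ultrafilter (Ultrafilter X), S ∈ 𝔛 ∧ ultrafilterSum 𝔛 = 𝔵 := by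
  -- Any ultrafilter finer than `F` has sum `𝔵`; the hypothesis says exactly that the basic sets of
  -- `F` meet `S`.
  let F : Filter (Ultrafilter X) :=
    (𝔵 : Filter X).lift' (fun A => {𝔷 : Ultrafilter X | A ∈ 𝔷})
  have hmono : Monotone (fun A : Set X => {𝔷 : Ultrafilter X | A ∈ 𝔷}) :=
    fun A B hAB 𝔷 h𝔷 => Filter.mem_of_superset h𝔷 hAB
  have hne : (F ⊓ Filter.principal S).NeBot := by
    rw [Filter.inf_principal_neBot_iff]
    intro U hU
    obtain ⟨A, hA, hAU⟩ := (Filter.mem_lift'_sets hmono).1 hU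
    obtain ⟨𝔷, h𝔷, hA𝔷⟩ := hS A hA
    exact ⟨𝔷, hAU hA𝔷, h𝔷⟩
  refine ⟨Ultrafilter.of (F ⊓ Filter.principal S), ?_, ?_⟩
  · exact Ultrafilter.of_le _ (Filter.mem_inf_of_right (Filter.mem_principal_self S))
  · refine Ultrafilter.eq_of_le fun A hA => ?_
    exact Ultrafilter.of_le _ (Filter.mem_inf_of_left (Filter.mem_lift' hA))

/-! ### From convergence to distances -/

namespace IsUltraConvergence

variable {X : Type*} {ℓ : Ultrafilter X → X → DistDistrib}

theorem distanceOf_transitive (h : IsUltraConvergence ℓ) (z : X) (A : Set X) (φ : DistDistrib) :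
    distanceOf ℓ z {y | φ ≤ distanceOf ℓ y A} ⊙ φ ≤ distanceOf ℓ z A := by
  refine iSup_conv_le fun 𝔶 => iSup_conv_le fun h𝔶 => ?_
  rw [conv_comm]
  refine conv_le_of_step_conv_le fun a u hu => ?_
  have hex : ∀ y, ∃ 𝔵 : Ultrafilter X,
      φ ≤ distanceOf ℓ y A → A ∈ 𝔵 ∧ step a u ≤ ℓ 𝔵 y := by
    intro y
    by_cases hy : φ ≤ distanceOf ℓ y A
    · rw [distanceOf, iSup_subtype'] at hy
      obtain ⟨𝔵, h𝔵⟩ := exists_step_le_of_le_iSup hy hu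
      exact ⟨𝔵, fun _ => ⟨𝔵.2, h𝔵⟩⟩
    -- An arbitrary value: these `y` lie outside a set belonging to `𝔶`.
    · exact ⟨pure y, fun h' => absurd h' hy⟩
  choose g hg using hex
  -- (T″) is applied to the image of `𝔶` under the choice `g` of witnessing ultrafilters.
  have hA : A ∈ ultrafilterSum (𝔶.map g) :=
    (mem_ultrafilterSum _ A).2 <| Ultrafilter.mem_map.2 <|
      Filter.mem_of_superset h𝔶 fun y hy => (hg y hy).1
  refine le_trans (conv_mono ?_ le_rfl) ((h.trans (𝔶.map g) 𝔶 z).trans (le_distanceOf ℓ z hA))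
  refine le_iInf₂ fun 𝒜 h𝒜 => le_iInf₂ fun B hB => ?_
  obtain ⟨y, ⟨hy𝒜, hyB⟩, hy⟩ :=
    Ultrafilter.nonempty_of_mem (Filter.inter_mem (Filter.inter_mem (Ultrafilter.mem_map.1 h𝒜) hB) h𝔶)
  exact le_iSup₂_of_le (g y) hy𝒜 (le_iSup₂_of_le y hyB (hg y hy).2)

theorem isProbApproach (h : IsUltraConvergence ℓ) : IsProbApproach (distanceOf ℓ) where
  singleton x := le_antisymm (le_kappa _)
    ((h.refl x).trans (le_distanceOf ℓ x (Ultrafilter.mem_pure.2 (Set.mem_singleton x))))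
  empty x := by
    rw [← bot_eq_zero]
    exact le_antisymm (iSup₂_le fun 𝔵 h𝔵 => absurd h𝔵 Ultrafilter.empty_notMem) bot_le
  union x A B := by
    refine le_antisymm (iSup₂_le fun 𝔵 h𝔵 => ?_) (sup_le
      (distanceOf_mono ℓ x Set.subset_union_left) (distanceOf_mono ℓ x Set.subset_union_right))
    rcases Ultrafilter.union_mem_iff.1 h𝔵 with hA | hB
    · exact (le_distanceOf ℓ x hA).trans le_sup_left
    · exact (le_distanceOf ℓ x hB).trans le_sup_right
  transitive := h.distanceOf_transitive

/-- Each member of `𝔵` lies in an ultrafilter that converges to `x` at least to degree `step a u`,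
so `𝔵` is a sum concentrated on such ultrafilters. (T″) with `𝔶 = pure x` passes the bound to `𝔵`,
(R″) supplying the neutral factor `kappa`. -/
theorem convergenceOf_distanceOf (h : IsUltraConvergence ℓ) :
    convergenceOf (distanceOf ℓ) = ℓ := by
  refine le_antisymm (fun 𝔵 x => le_of_step_le fun a u hu => ?_) (le_convergenceOf_distanceOf ℓ)
  have hS : ∀ A ∈ 𝔵, ∃ 𝔷 ∈ {𝔷 | step a u ≤ ℓ 𝔷 x}, A ∈ 𝔷 := by
    intro A hA
    have hle := convergenceOf_le (distanceOf ℓ) x hA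
    rw [distanceOf, iSup_subtype'] at hle
    obtain ⟨𝔷, h𝔷⟩ := exists_step_le_of_le_iSup hle hu
    exact ⟨𝔷, h𝔷, 𝔷.2⟩
  obtain ⟨𝔛, hS𝔛, rfl⟩ := exists_ultrafilterSum_eq hS
  refine le_trans (le_conv_kappa _)
    (le_trans (conv_mono ?_ (h.refl x)) (h.trans 𝔛 (pure x) x))
  refine le_iInf₂ fun 𝒜 h𝒜 => le_iInf₂ fun B hB => ?_
  obtain ⟨𝔷, h𝔷𝒜, h𝔷⟩ := Ultrafilter.nonempty_of_mem (Filter.inter_mem h𝒜 hS𝔛)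
  exact le_iSup₂_of_le 𝔷 h𝔷𝒜 (le_iSup₂_of_le x (Ultrafilter.mem_pure.1 hB) h𝔷)

end IsUltraConvergence

theorem isContractive_iff_convergenceOf_le {X Y : Type*} {δ : X → Set X → DistDistrib}
    {ε : Y → Set Y → DistDistrib} (hδ : IsProbApproach δ) (hε : IsProbApproach ε) (f : X → Y) :
    IsContractive δ ε f ↔ ∀ (𝔵 : Ultrafilter X) (x : X),
      convergenceOf δ 𝔵 x ≤ convergenceOf ε (𝔵.map f) (f x) := by
  constructor
  · intro hf 𝔵 x
    refine le_iInf₂ fun B hB => ?_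
    exact (convergenceOf_le δ x (Ultrafilter.mem_map.1 hB)).trans <|
      (hf x _).trans (hε.mono _ (Set.image_preimage_subset f B))
  · intro hf x A
    rw [← hδ.distanceOf_convergenceOf]
    refine iSup₂_le fun 𝔵 hA => (hf 𝔵 x).trans (convergenceOf_le ε (f x) ?_)
    exact Ultrafilter.mem_map.2 (Filter.mem_of_superset hA (Set.subset_preimage_image f A))

theorem corollary3p7 {X : Type*} {Y : Type*} :
    -- The two assignments are mutually inverse bijections between the probabilistic approach
    -- structures on `X` and the reflexive and transitive maps `UX → Δ^X`.
    ((∀ δ : X → Set X → DistDistrib, IsProbApproach δ →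
        IsUltraConvergence (convergenceOf δ) ∧ distanceOf (convergenceOf δ) = δ) ∧
      (∀ ℓ : Ultrafilter X → X → DistDistrib, IsUltraConvergence ℓ →
        IsProbApproach (distanceOf ℓ) ∧ convergenceOf (distanceOf ℓ) = ℓ)) ∧
    -- Contractivity in terms of the corresponding maps `ℓ`, `ℓ'`.
    (∀ (δ : X → Set X → DistDistrib) (ε : Y → Set Y → DistDistrib),
      IsProbApproach δ → IsProbApproach ε → ∀ f : X → Y,
        (IsContractive δ ε f ↔
          ∀ (𝔵 : Ultrafilter X) (x : X),
            convergenceOf δ 𝔵 x ≤ convergenceOf ε (𝔵.map f) (f x))) := by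
  exact ⟨⟨fun δ hδ => ⟨hδ.isUltraConvergence, hδ.distanceOf_convergenceOf⟩,
    fun ℓ hℓ => ⟨hℓ.isProbApproach, hℓ.convergenceOf_distanceOf⟩⟩,
    fun δ ε hδ hε f => isContractive_iff_convergenceOf_le hδ hε f⟩
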